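/- Let $S_n$ be the symmetric group on $\{1,\dots,n\}$ with simple reflections $s_i=(i\ \ i+1)$, $1\le i\le n-1$. The Iwahori--Hecke algebra $\mathcal H$ of $S_n$ is the associative unital $\mathbb Z[\xi]$-algebra ($\xi$ an indeterminate) with generators $\tilde T_{s_1},\dots,\tilde T_{s_{n-1}}$ and relations $\tilde T_{s_i}\tilde T_{s_j}=\tilde T_{s_j}\tilde T_{s_i}$ for $|i-j|\ge 2$, $\tilde T_{s_i}\tilde T_{s_{i+1}}\tilde T_{s_i}=\tilde T_{s_{i+1}}\tilde T_{s_i}\tilde T_{s_{i+1}}$ for $1\le i\le n-2$, and $\tilde T_{s_i}^2=1+\xi\tilde T_{s_i}$. For a reduced expression $w=s_{i_1}\cdots s_{i_r}$ put $\tilde T_w=\tilde T_{s_{i_1}}\cdots\tilde T_{s_{i_r}}$; the elements $\tilde T_w$, $w\in S_n$, form a $\mathbb Z[\xi]$-basis of $\mathcal H$, and $f_{xyz}$ denotes the coefficient of $\tilde T_z$ in $\tilde T_x\tilde T_y$. Fix $k\in\{1,\dots,n-1\}$. For $w\in S_n$ let $\#(w)$ be the minimal number of occurrences of $s_k$ in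 a reduced expression for $w$. For $0\le m\le\min\{k,n-k\}$ let $$d_m=(k\ \ k+m)(k-1\ \ k+m-1)\cdots(k+1-m\ \ k+1),$$ let $S_{(k,n-k)}$ be the subgroup generated by the $s_i$ with $i\ne k$, and let $P_m=S_{(k,n-k)}\cap d_m^{-1}S_{(k,n-k)}d_m$. (1) There are $f_w\in\mathbb N[\xi]$ $(w\in S_n)$ with $$(\tilde T_{d_m})^2=\tilde T_1+\sum_{w\in S_n}f_w\tilde T_w,$$ such that $\#(w)\ge 1$ whenever $f_w\ne 0$, and $f_w=f_{d_md_mw}$ for all $w\neq 1$. (2) Consequently, for every $v\in P_m$ there are $g_w\in\mathbb N[\xi]$ $(w\in S_n)$ with $$\tilde T_{d_m}\tilde T_v\tilde T_{d_m}=\tilde T_{d_mvd_m}+\sum_{w\in S_n}g_w\tilde T_w,$$ such that $\#(w)\ge 1$ whenever $g_w\ne 0$. -/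

import Mathlib

open Polynomial

namespace HeckeSym

/-- The indices `1, …, n - 1` of the simple reflections of the symmetric group on `n` letters. -/
abbrev Idx (n : ℕ) : Type := {i : ℕ // 1 ≤ i ∧ i < n}

/-- The letter `a ∈ {1, …, n}` as an element of `Fin n` (which counts from `0`). -/
def letter {n : ℕ} (a : ℕ) (h : 1 ≤ a ∧ a ≤ n) : Fin n := ⟨a - 1, by omega⟩

/-- The simple reflection `s_i = (i  i+1)`. -/
def simple {n : ℕ} (i : Idx n) : Equiv.Perm (Fin n) :=
  Equiv.swap (letter i.1 ⟨i.2.1, i.2.2.le⟩) (letter (i.1 + 1) ⟨by omega, i.2.2⟩)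

/-- The element `s_{i_1} ⋯ s_{i_r}` expressed by the word `(i_1, …, i_r)`. -/
def wordProd {n : ℕ} (l : List (Idx n)) : Equiv.Perm (Fin n) := (l.map simple).prod

/-- A word is reduced if no word with fewer letters expresses the same element. -/
def IsReduced {n : ℕ} (l : List (Idx n)) : Prop :=
  ∀ l' : List (Idx n), wordProd l' = wordProd l → l.length ≤ l'.length

/-! ### Ascents and inversions: every element has a reduced word -/

/-- `s_i w` is longer than `w`. -/
def Asc {n : ℕ} (i : Idx n) (w : Equiv.Perm (Fin n)) : Prop :=
  w⁻¹ (letter i.1 ⟨i.2.1, i.2.2.le⟩) < w⁻¹ (letter (i.1 + 1) ⟨by omega, i.2.2⟩)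

/-- The set of inversions of `w`. -/
def invSet {n : ℕ} (w : Equiv.Perm (Fin n)) : Finset (Fin n × Fin n) :=
  {p | p.1 < p.2 ∧ w p.2 < w p.1}

theorem mem_invSet {n : ℕ} (w : Equiv.Perm (Fin n)) (p : Fin n × Fin n) :
    p ∈ invSet w ↔ p.1.1 < p.2.1 ∧ (w p.2).1 < (w p.1).1 := by
  simp [invSet]

theorem invSet_one {n : ℕ} : invSet (1 : Equiv.Perm (Fin n)) = ∅ := by
  ext p
  rw [mem_invSet, Equiv.Perm.one_apply, Equiv.Perm.one_apply]
  simp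
  omega

theorem simple_mul_self {n : ℕ} (i : Idx n) : simple i * simple i = 1 :=
  Equiv.swap_mul_self _ _

theorem simple_mul_cancel {n : ℕ} (i : Idx n) (w : Equiv.Perm (Fin n)) :
    simple i * (simple i * w) = w := by
  rw [← mul_assoc, simple_mul_self, one_mul]

theorem simple_val {n : ℕ} (i : Idx n) (x : Fin n) :
    (simple i x).1 = if x.1 + 1 = i.1 then i.1 else if x.1 = i.1 then i.1 - 1 else x.1 := by
  have := i.2
  simp only [simple, letter, Equiv.swap_apply_def, Fin.ext_iff]
  split_ifs <;> simp at * <;> omega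

theorem simple_inv {n : ℕ} (i : Idx n) : (simple i)⁻¹ = simple i := Equiv.swap_inv _ _

theorem simple_comm {n : ℕ} (i j : Idx n) (h : i.1 + 2 ≤ j.1 ∨ j.1 + 2 ≤ i.1) :
    simple i * simple j = simple j * simple i := by
  ext x
  have := i.2; have := j.2
  simp only [Equiv.Perm.mul_apply, simple_val]
  split_ifs <;> omega

theorem simple_braid {n : ℕ} (i j : Idx n) (h : j.1 = i.1 + 1) :
    simple i * simple j * simple i = simple j * simple i * simple j := by
  obtain ⟨i, hi⟩ := i
  obtain ⟨j, hj⟩ := j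
  subst h
  simp only [simple]
  rw [Equiv.swap_comm (letter i _), Equiv.swap_comm (letter (i + 1) _) (letter (i + 1 + 1) _),
    Equiv.swap_mul_swap_mul_swap, Equiv.swap_comm (letter (i + 1) _) (letter i _),
    Equiv.swap_comm (letter (i + 1 + 1) _) (letter (i + 1) _),
    Equiv.swap_mul_swap_mul_swap, Equiv.swap_comm]
  all_goals simp [letter]
  all_goals omega

theorem asc_simple_mul {n : ℕ} (i : Idx n) (w : Equiv.Perm (Fin n)) :
    Asc i (simple i * w) ↔ ¬ Asc i w := by
  simp only [Asc, mul_inv_rev, simple_inv, Equiv.Perm.mul_apply]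
  simp only [simple, Equiv.swap_apply_left, Equiv.swap_apply_right, not_lt]
  refine ⟨le_of_lt, fun h => lt_of_le_of_ne h fun h' => ?_⟩
  have := i.2
  simp [letter] at h'
  omega

theorem card_invSet_of_asc {n : ℕ} {i : Idx n} {w : Equiv.Perm (Fin n)} (h : Asc i w) :
    (invSet (simple i * w)).card = (invSet w).card + 1 := by
  set p := w⁻¹ (letter i.1 ⟨i.2.1, i.2.2.le⟩) with hp
  set q := w⁻¹ (letter (i.1 + 1) ⟨by omega, i.2.2⟩) with hq
  have hi := i.2
  have hwp : (w p).1 = i.1 - 1 := by simp [hp, letter]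
  have hwq : (w q).1 = i.1 := by simp [hq, letter]
  have hlt : p < q := h
  have hnot : (p, q) ∉ invSet w := by
    rw [mem_invSet]
    simp only
    omega
  rw [← Finset.card_insert_of_notMem hnot]
  congr 1
  ext ⟨x, y⟩
  simp only [mem_invSet, Finset.mem_insert, Prod.mk.injEq, Equiv.Perm.mul_apply]
  have hx : x = p ↔ (w x).1 = i.1 - 1 := by
    rw [← w.injective.eq_iff, Fin.ext_iff, hwp]
  have hy : y = q ↔ (w y).1 = i.1 := by
    rw [← w.injective.eq_iff, Fin.ext_iff, hwq]
  have hx' : x = q ↔ (w x).1 = i.1 := by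
    rw [← w.injective.eq_iff, Fin.ext_iff, hwq]
  have hy' : y = p ↔ (w y).1 = i.1 - 1 := by
    rw [← w.injective.eq_iff, Fin.ext_iff, hwp]
  have hxy : x = y ↔ (w x).1 = (w y).1 := by
    rw [← w.injective.eq_iff, Fin.ext_iff]
  rw [Fin.lt_def] at hlt
  simp only [simple_val]
  simp only [Fin.ext_iff] at hx hy hx' hy' hxy ⊢
  split_ifs <;> omega

theorem card_invSet_of_not_asc {n : ℕ} {i : Idx n} {w : Equiv.Perm (Fin n)} (h : ¬ Asc i w) :
    (invSet (simple i * w)).card + 1 = (invSet w).card := by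
  have := card_invSet_of_asc ((asc_simple_mul i w).2 h)
  rw [simple_mul_cancel] at this
  exact this.symm

theorem exists_not_asc {n : ℕ} {w : Equiv.Perm (Fin n)} (hw : w ≠ 1) : ∃ i : Idx n, ¬ Asc i w := by
  by_contra! H
  apply hw
  have hmono : StrictMono (w⁻¹ : Equiv.Perm (Fin n)) := by
    rcases n with _ | n
    · exact fun a => a.elim0
    · rw [Fin.strictMono_iff_lt_succ]
      intro a
      have := H ⟨a.1 + 1, by omega, by omega⟩
      simpa [Asc, letter, Fin.succ, Fin.castSucc, Fin.castAdd, Fin.castLE] using this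
  have h2 : (hmono.orderIsoOfSurjective _ (w⁻¹).surjective) = OrderIso.refl _ :=
    Subsingleton.elim _ _
  have h3 : w⁻¹ = 1 := by
    ext x
    have := congrArg (fun e => (e x).1) h2
    simpa using this
  simpa using h3

theorem wordProd_cons {n : ℕ} (i : Idx n) (l : List (Idx n)) :
    wordProd (i :: l) = simple i * wordProd l := by simp [wordProd]

theorem exists_word {n : ℕ} (w : Equiv.Perm (Fin n)) :
    ∃ l : List (Idx n), wordProd l = w ∧ l.length = (invSet w).card := by
  induction hN : (invSet w).card generalizing w with
  | zero =>
    by_cases hw : w = 1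
    · exact ⟨[], by simp [wordProd, hw], rfl⟩
    · obtain ⟨i, hi⟩ := exists_not_asc hw
      have := card_invSet_of_not_asc hi
      omega
  | succ N ih =>
    have hw : w ≠ 1 := by
      rintro rfl
      simp [invSet_one] at hN
    obtain ⟨i, hi⟩ := exists_not_asc hw
    have := card_invSet_of_not_asc hi
    obtain ⟨l, hl, hlen⟩ := ih (simple i * w) (by omega)
    exact ⟨i :: l, by rw [wordProd_cons, hl, simple_mul_cancel], by simp [hlen]⟩

theorem card_invSet_le {n : ℕ} (l : List (Idx n)) : (invSet (wordProd l)).card ≤ l.length := by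
  induction l with
  | nil => simp [wordProd, invSet_one]
  | cons i l ih =>
    rw [wordProd_cons, List.length_cons]
    by_cases h : Asc i (wordProd l)
    · have := card_invSet_of_asc h; omega
    · have := card_invSet_of_not_asc h; omega

theorem isReduced_iff {n : ℕ} (l : List (Idx n)) :
    IsReduced l ↔ l.length = (invSet (wordProd l)).card := by
  constructor
  · intro h
    obtain ⟨l', h1, h2⟩ := exists_word (wordProd l)
    exact le_antisymm (h2 ▸ h l' h1) (card_invSet_le l)
  · intro h l' h'
    rw [h, ← h']
    exact card_invSet_le l'

theorem exists_reduced {n : ℕ} (w : Equiv.Perm (Fin n)) :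
    ∃ l : List (Idx n), IsReduced l ∧ wordProd l = w := by
  obtain ⟨l, h1, h2⟩ := exists_word w
  exact ⟨l, (isReduced_iff l).2 (by rw [h1, h2]), h1⟩

theorem isReduced_cons {n : ℕ} (i : Idx n) (l : List (Idx n)) :
    IsReduced (i :: l) ↔ IsReduced l ∧ Asc i (wordProd l) := by
  rw [isReduced_iff, isReduced_iff, wordProd_cons, List.length_cons]
  have := card_invSet_le l
  by_cases h : Asc i (wordProd l)
  · have := card_invSet_of_asc h
    simp only [h, and_true]; omega
  · have := card_invSet_of_not_asc h
    simp only [h, and_false, iff_false]; omega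


/-! ### Words in a monoid satisfying the braid relations -/

theorem reduced_word_independent {n : ℕ} {M : Type*} [Monoid M] (f : Idx n → M)
    (hc : ∀ i j : Idx n, i.1 + 2 ≤ j.1 → f i * f j = f j * f i)
    (hb : ∀ i j : Idx n, j.1 = i.1 + 1 → f i * f j * f i = f j * f i * f j)
    (l l' : List (Idx n)) (hl : IsReduced l) (hl' : IsReduced l')
    (h : wordProd l = wordProd l') : (l.map f).prod = (l'.map f).prod := by
  induction hN : l.length using Nat.strong_induction_on generalizing l l' with
  | _ N ih =>
  have hlen : l.length = l'.length := by
    rw [(isReduced_iff l).1 hl, (isReduced_iff l').1 hl', h]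
  rcases l with _ | ⟨i, α⟩
  · rw [List.length_nil] at hlen
    rw [List.length_eq_zero_iff.1 hlen.symm]
  rcases l' with _ | ⟨j, β⟩
  · simp at hlen
  have hα := ((isReduced_cons i α).1 hl)
  have hβ := ((isReduced_cons j β).1 hl')
  simp only [List.length_cons] at hlen hN
  rw [wordProd_cons, wordProd_cons] at h
  -- the claim for `f` applied to two words with the same first letter
  have key : ∀ (i : Idx n) (γ δ : List (Idx n)), IsReduced (i :: γ) → IsReduced (i :: δ) →
      wordProd (i :: γ) = wordProd (i :: δ) → γ.length < N →
      ((i :: γ).map f).prod = ((i :: δ).map f).prod := by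
    intro i γ δ h1 h2 h3 h4
    rw [wordProd_cons, wordProd_cons] at h3
    simp only [List.map_cons, List.prod_cons]
    rw [ih γ.length h4 γ δ ((isReduced_cons i γ).1 h1).1 ((isReduced_cons i δ).1 h2).1
      (mul_left_cancel h3) rfl]
  set w := simple i * wordProd α with hw
  have hiw : ¬ Asc i w := fun h' => (asc_simple_mul i _).1 h' hα.2
  have hjw : ¬ Asc j w := fun h' => (asc_simple_mul j _).1 (h ▸ h') hβ.2
  by_cases hij : i = j
  · subst hij
    exact key i α β hl hl' (by rw [wordProd_cons, wordProd_cons, ← hw, h]) (by omega)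
  -- a reduced word of `w` starting with `i` and one starting with `j`, equal under `f`
  suffices H : ∀ i j : Idx n, i.1 < j.1 → ¬ Asc i w → ¬ Asc j w →
      ∃ γ δ : List (Idx n), IsReduced (i :: γ) ∧ IsReduced (j :: δ) ∧ wordProd (i :: γ) = w ∧
        wordProd (j :: δ) = w ∧ ((i :: γ).map f).prod = ((j :: δ).map f).prod by
    obtain ⟨γ, δ, h1, h2, h3, h4, h5⟩ : ∃ γ δ : List (Idx n), IsReduced (i :: γ) ∧
        IsReduced (j :: δ) ∧ wordProd (i :: γ) = w ∧
        wordProd (j :: δ) = w ∧ ((i :: γ).map f).prod = ((j :: δ).map f).prod := by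
      rcases lt_or_gt_of_ne (fun e => hij (Subtype.ext e)) with hlt | hlt
      · exact H i j hlt hiw hjw
      · obtain ⟨γ, δ, h1, h2, h3, h4, h5⟩ := H j i hlt hjw hiw
        exact ⟨δ, γ, h2, h1, h4, h3, h5.symm⟩
    rw [key i α γ hl h1 (by rw [wordProd_cons, ← hw, h3]) (by omega), h5,
      ← key j β δ hl' h2 (by rw [wordProd_cons, ← h, h4]) (by omega)]
  clear_value w
  intro i j hlt hi hj
  have red : ∀ (i : Idx n) (γ : List (Idx n)) (u : Equiv.Perm (Fin n)), IsReduced γ →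
      wordProd γ = u → Asc i u → IsReduced (i :: γ) := fun i γ u h1 h2 h3 =>
    (isReduced_cons i γ).2 ⟨h1, by rw [h2]; exact h3⟩
  have hi2 := i.2
  have hj2 := j.2
  set x := w⁻¹ (letter i.1 ⟨i.2.1, i.2.2.le⟩) with hx
  set y := w⁻¹ (letter (i.1 + 1) ⟨by omega, i.2.2⟩) with hy
  have hxy : y < x := by
    refine lt_of_le_of_ne (not_lt.1 hi) fun e => ?_
    have := (w⁻¹).injective e
    simp [letter] at this
    omega
  by_cases hfar : i.1 + 2 ≤ j.1
  · obtain ⟨γ, hγ, hγw⟩ := exists_reduced (simple i * (simple j * w))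
    have e1 : simple i * (simple j * w) = simple j * (simple i * w) := by
      rw [← mul_assoc, ← mul_assoc, simple_comm i j (Or.inl hfar)]
    have a1 : Asc i (simple i * (simple j * w)) := by
      rw [asc_simple_mul]
      intro h'
      apply hi
      simp only [Asc, mul_inv_rev, simple_inv, Equiv.Perm.mul_apply] at h' ⊢
      rwa [simple, Equiv.swap_apply_of_ne_of_ne, Equiv.swap_apply_of_ne_of_ne] at h' <;>
        simp [letter] <;> omega
    have a2 : Asc j (simple i * (simple j * w)) := by
      rw [e1, asc_simple_mul]
      intro h'
      apply hj
      simp only [Asc, mul_inv_rev, simple_inv, Equiv.Perm.mul_apply] at h' ⊢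
      rwa [simple, Equiv.swap_apply_of_ne_of_ne, Equiv.swap_apply_of_ne_of_ne] at h' <;>
        simp [letter] <;> omega
    have b1 := red i γ _ hγ hγw a1
    have b2 := red j γ _ hγ hγw a2
    refine ⟨j :: γ, i :: γ, red i _ (simple i * w) b2 ?_ ((asc_simple_mul i w).2 hi),
      red j _ (simple j * w) b1 ?_ ((asc_simple_mul j w).2 hj), ?_, ?_, ?_⟩
    · rw [wordProd_cons, hγw, e1, simple_mul_cancel]
    · rw [wordProd_cons, hγw, simple_mul_cancel]
    · rw [wordProd_cons, wordProd_cons, hγw, e1, simple_mul_cancel, simple_mul_cancel]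
    · rw [wordProd_cons, wordProd_cons, hγw, simple_mul_cancel, simple_mul_cancel]
    · simp only [List.map_cons, List.prod_cons]
      rw [← mul_assoc, ← mul_assoc, hc i j hfar]
  · have hj1 : j.1 = i.1 + 1 := by omega
    obtain ⟨i, hi3⟩ := i
    obtain ⟨j, hj3⟩ := j
    dsimp only at hj1
    subst hj1
    set I : Idx n := ⟨i, hi3⟩
    set J : Idx n := ⟨i + 1, hj3⟩
    set z := w⁻¹ (letter (i + 1 + 1) ⟨by omega, hj3.2⟩) with hz
    have hyz : z < y := by
      refine lt_of_le_of_ne (not_lt.1 hj) fun e => ?_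
      have := (w⁻¹).injective e
      simp [letter] at this
    have sI1 : simple I (letter i ⟨hi3.1, hi3.2.le⟩) = letter (i + 1) ⟨by omega, hi3.2⟩ :=
      Equiv.swap_apply_left _ _
    have sI2 : simple I (letter (i + 1) ⟨by omega, hi3.2⟩) = letter i ⟨hi3.1, hi3.2.le⟩ :=
      Equiv.swap_apply_right _ _
    have sI3 : simple I (letter (i + 1 + 1) ⟨by omega, hj3.2⟩)
        = letter (i + 1 + 1) ⟨by omega, hj3.2⟩ :=
      Equiv.swap_apply_of_ne_of_ne (by simp [letter, I]; omega) (by simp [letter, I])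
    have sJ1 : simple J (letter (i + 1) ⟨by omega, hi3.2⟩)
        = letter (i + 1 + 1) ⟨by omega, hj3.2⟩ :=
      Equiv.swap_apply_left _ _
    have sJ2 : simple J (letter (i + 1 + 1) ⟨by omega, hj3.2⟩)
        = letter (i + 1) ⟨by omega, hi3.2⟩ :=
      Equiv.swap_apply_right _ _
    have sJ3 : simple J (letter i ⟨hi3.1, hi3.2.le⟩) = letter i ⟨hi3.1, hi3.2.le⟩ :=
      Equiv.swap_apply_of_ne_of_ne (by simp [letter, J]; omega) (by simp [letter, J])
    obtain ⟨γ, hγ, hγw⟩ := exists_reduced (simple I * (simple J * (simple I * w)))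
    have e1 : simple I * (simple J * (simple I * w)) = simple J * (simple I * (simple J * w)) := by
      simp only [← mul_assoc]
      rw [simple_braid I J rfl]
    have aJ1 : ¬ Asc J (simple I * w) := by
      simp only [Asc, mul_inv_rev, simple_inv, Equiv.Perm.mul_apply]
      change ¬ w⁻¹ (simple I (letter (i + 1) _)) < w⁻¹ (simple I (letter (i + 1 + 1) _))
      rw [sI2, sI3]; exact not_lt.2 (hyz.trans hxy).le
    have aI1 : ¬ Asc I (simple J * w) := by
      simp only [Asc, mul_inv_rev, simple_inv, Equiv.Perm.mul_apply]
      change ¬ w⁻¹ (simple J (letter i _)) < w⁻¹ (simple J (letter (i + 1) _))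
      rw [sJ3, sJ1]; exact not_lt.2 (hyz.trans hxy).le
    have aI2 : ¬ Asc I (simple J * (simple I * w)) := by
      simp only [Asc, mul_inv_rev, simple_inv, Equiv.Perm.mul_apply]
      change ¬ w⁻¹ (simple I (simple J (letter i _))) < w⁻¹ (simple I (simple J (letter (i + 1) _)))
      rw [sJ3, sJ1, sI1, sI3]; exact not_lt.2 hyz.le
    have aJ2 : ¬ Asc J (simple I * (simple J * w)) := by
      simp only [Asc, mul_inv_rev, simple_inv, Equiv.Perm.mul_apply]
      change ¬ w⁻¹ (simple J (simple I (letter (i + 1) _)))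
        < w⁻¹ (simple J (simple I (letter (i + 1 + 1) _)))
      rw [sI2, sI3, sJ3, sJ2]; exact not_lt.2 hxy.le
    have b1 := red I γ _ hγ hγw ((asc_simple_mul I _).2 aI2)
    have p1 : wordProd (I :: γ) = simple J * (simple I * w) := by
      rw [wordProd_cons, hγw, simple_mul_cancel]
    have b2 := red J _ _ b1 p1 ((asc_simple_mul J _).2 aJ1)
    have p2 : wordProd (J :: I :: γ) = simple I * w := by
      rw [wordProd_cons, p1, simple_mul_cancel]
    have b3 := red I _ _ b2 p2 ((asc_simple_mul I _).2 hi)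
    have c1 := red J γ _ hγ (hγw.trans e1) ((asc_simple_mul J _).2 aJ2)
    have q1 : wordProd (J :: γ) = simple I * (simple J * w) := by
      rw [wordProd_cons, hγw, e1, simple_mul_cancel]
    have c2 := red I _ _ c1 q1 ((asc_simple_mul I _).2 aI1)
    have q2 : wordProd (I :: J :: γ) = simple J * w := by
      rw [wordProd_cons, q1, simple_mul_cancel]
    have c3 := red J _ _ c2 q2 ((asc_simple_mul J _).2 hj)
    refine ⟨J :: I :: γ, I :: J :: γ, b3, c3, ?_, ?_, ?_⟩
    · rw [wordProd_cons, p2, simple_mul_cancel]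
    · rw [wordProd_cons, q2, simple_mul_cancel]
    · simp only [List.map_cons, List.prod_cons, ← mul_assoc]
      rw [hb I J rfl]

/-! ### The Iwahori–Hecke algebra -/

/-- The defining relations of the Iwahori–Hecke algebra with its normalized generators;
the indeterminate `ξ` is `X : ℤ[X]`. -/
inductive HeckeRel (n : ℕ) : FreeAlgebra ℤ[X] (Idx n) → FreeAlgebra ℤ[X] (Idx n) → Prop
  | comm (i j : Idx n) (h : i.1 + 2 ≤ j.1 ∨ j.1 + 2 ≤ i.1) :
      HeckeRel n (FreeAlgebra.ι ℤ[X] i * FreeAlgebra.ι ℤ[X] j)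
        (FreeAlgebra.ι ℤ[X] j * FreeAlgebra.ι ℤ[X] i)
  | braid (i j : Idx n) (h : j.1 = i.1 + 1) :
      HeckeRel n (FreeAlgebra.ι ℤ[X] i * FreeAlgebra.ι ℤ[X] j * FreeAlgebra.ι ℤ[X] i)
        (FreeAlgebra.ι ℤ[X] j * FreeAlgebra.ι ℤ[X] i * FreeAlgebra.ι ℤ[X] j)
  | quad (i : Idx n) :
      HeckeRel n (FreeAlgebra.ι ℤ[X] i * FreeAlgebra.ι ℤ[X] i)
        (1 + (X : ℤ[X]) • FreeAlgebra.ι ℤ[X] i)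

/-- The Iwahori–Hecke algebra `ℋ_n` of the symmetric group on `n` letters over `ℤ[ξ]`. -/
abbrev HeckeAlgebra (n : ℕ) : Type := RingQuot (HeckeRel n)

/-- The generator `T_{s_i}` of the Iwahori–Hecke algebra. -/
noncomputable def gen {n : ℕ} (i : Idx n) : HeckeAlgebra n :=
  RingQuot.mkAlgHom ℤ[X] (HeckeRel n) (FreeAlgebra.ι ℤ[X] i)

/-- `T_w = T_{s_{i_1}} ⋯ T_{s_{i_r}}` for a reduced word `(i_1, …, i_r)` of `w`; by
`T_eq` below the choice of the reduced word does not matter. -/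
noncomputable def T {n : ℕ} (w : Equiv.Perm (Fin n)) : HeckeAlgebra n :=
  ((exists_reduced w).choose.map gen).prod

theorem gen_comm {n : ℕ} (i j : Idx n) (h : i.1 + 2 ≤ j.1) :
    gen i * gen j = gen j * gen i := by
  simpa [gen] using RingQuot.mkAlgHom_rel ℤ[X] (HeckeRel.comm i j (Or.inl h))

theorem gen_braid {n : ℕ} (i j : Idx n) (h : j.1 = i.1 + 1) :
    gen i * gen j * gen i = gen j * gen i * gen j := by
  simpa [gen] using RingQuot.mkAlgHom_rel ℤ[X] (HeckeRel.braid i j h)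

theorem gen_sq {n : ℕ} (i : Idx n) : gen i * gen i = 1 + (X : ℤ[X]) • gen i := by
  simpa [gen] using RingQuot.mkAlgHom_rel ℤ[X] (HeckeRel.quad i)

theorem T_eq {n : ℕ} (w : Equiv.Perm (Fin n)) (l : List (Idx n)) (hl : IsReduced l)
    (h : wordProd l = w) : T w = (l.map gen).prod :=
  reduced_word_independent gen gen_comm gen_braid _ l (exists_reduced w).choose_spec.1 hl
    ((exists_reduced w).choose_spec.2.trans h.symm)

theorem T_one {n : ℕ} : T (1 : Equiv.Perm (Fin n)) = 1 :=
  T_eq 1 [] (fun _ _ => Nat.zero_le _) rfl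

theorem gen_mul_T_of_asc {n : ℕ} {i : Idx n} {w : Equiv.Perm (Fin n)} (h : Asc i w) :
    gen i * T w = T (simple i * w) := by
  obtain ⟨l, hl, hw⟩ := exists_reduced w
  rw [T_eq w l hl hw, T_eq (simple i * w) (i :: l) ((isReduced_cons i l).2 ⟨hl, hw ▸ h⟩)
    (by rw [wordProd_cons, hw])]
  simp

theorem gen_mul_T_of_not_asc {n : ℕ} {i : Idx n} {w : Equiv.Perm (Fin n)} (h : ¬ Asc i w) :
    gen i * T w = T (simple i * w) + (X : ℤ[X]) • T w := by
  have h1 := gen_mul_T_of_asc ((asc_simple_mul i w).2 h)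
  rw [simple_mul_cancel] at h1
  rw [← h1, ← mul_assoc, gen_sq, add_mul, one_mul, smul_mul_assoc]

/-! ### The basis `T_w` -/

open Classical in
/-- Left multiplication by `T_{s_i}` in coordinates. -/
noncomputable def leftOp {n : ℕ} (i : Idx n) : Module.End ℤ[X] (Equiv.Perm (Fin n) →₀ ℤ[X]) :=
  Finsupp.linearCombination ℤ[X] fun w =>
    Finsupp.single (simple i * w) 1 + if Asc i w then 0 else (X : ℤ[X]) • Finsupp.single w 1

theorem leftOp_of_asc {n : ℕ} {i : Idx n} {w : Equiv.Perm (Fin n)} (h : Asc i w) :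
    leftOp i (Finsupp.single w 1) = Finsupp.single (simple i * w) 1 := by
  simp [leftOp, h]

theorem leftOp_of_not_asc {n : ℕ} {i : Idx n} {w : Equiv.Perm (Fin n)} (h : ¬ Asc i w) :
    leftOp i (Finsupp.single w 1)
      = Finsupp.single (simple i * w) 1 + (X : ℤ[X]) • Finsupp.single w 1 := by
  simp [leftOp, h]

theorem leftOp_sq {n : ℕ} (i : Idx n) :
    leftOp i * leftOp i = 1 + (X : ℤ[X]) • leftOp i := by
  apply Finsupp.lhom_ext'
  intro w
  apply LinearMap.ext_ring
  simp only [LinearMap.comp_apply, Finsupp.lsingle_apply, Module.End.mul_apply,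
    LinearMap.add_apply, LinearMap.smul_apply, Module.End.one_apply]
  by_cases h : Asc i w
  · have h2 : ¬ Asc i (simple i * w) := fun h' => (asc_simple_mul i w).1 h' h
    rw [leftOp_of_asc h, leftOp_of_not_asc h2, simple_mul_cancel]
  · rw [leftOp_of_not_asc h, map_add, map_smul, leftOp_of_asc ((asc_simple_mul i w).2 h),
      simple_mul_cancel, leftOp_of_not_asc h]

theorem leftOp_comm {n : ℕ} (i j : Idx n) (h : i.1 + 2 ≤ j.1) :
    leftOp i * leftOp j = leftOp j * leftOp i := by
  have hi := i.2
  have hj := j.2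
  apply Finsupp.lhom_ext'
  intro w
  apply LinearMap.ext_ring
  simp only [LinearMap.comp_apply, Finsupp.lsingle_apply, Module.End.mul_apply]
  have a1 : Asc i (simple j * w) ↔ Asc i w := by
    simp only [Asc, mul_inv_rev, simple_inv, Equiv.Perm.mul_apply]
    rw [simple, Equiv.swap_apply_of_ne_of_ne, Equiv.swap_apply_of_ne_of_ne] <;>
      simp [letter] <;> omega
  have a2 : Asc j (simple i * w) ↔ Asc j w := by
    simp only [Asc, mul_inv_rev, simple_inv, Equiv.Perm.mul_apply]
    rw [simple, Equiv.swap_apply_of_ne_of_ne, Equiv.swap_apply_of_ne_of_ne] <;>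
      simp [letter] <;> omega
  have e : simple i * (simple j * w) = simple j * (simple i * w) := by
    rw [← mul_assoc, ← mul_assoc, simple_comm i j (Or.inl h)]
  simp only [leftOp, Finsupp.linearCombination_single, one_smul, map_add, a1, a2, e]
  by_cases h1 : Asc i w <;> by_cases h2 : Asc j w <;> (simp [h1, h2, a1, a2]; try abel)

theorem leftOp_braid {n : ℕ} (i j : Idx n) (h : j.1 = i.1 + 1) :
    leftOp i * leftOp j * leftOp i = leftOp j * leftOp i * leftOp j := by
  obtain ⟨i, hi3⟩ := i
  obtain ⟨j, hj3⟩ := j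
  dsimp only at h
  subst h
  set I : Idx n := ⟨i, hi3⟩
  set J : Idx n := ⟨i + 1, hj3⟩
  have sI1 : simple I (letter i ⟨hi3.1, hi3.2.le⟩) = letter (i + 1) ⟨by omega, hi3.2⟩ :=
    Equiv.swap_apply_left _ _
  have sI2 : simple I (letter (i + 1) ⟨by omega, hi3.2⟩) = letter i ⟨hi3.1, hi3.2.le⟩ :=
    Equiv.swap_apply_right _ _
  have sI3 : simple I (letter (i + 1 + 1) ⟨by omega, hj3.2⟩)
      = letter (i + 1 + 1) ⟨by omega, hj3.2⟩ :=
    Equiv.swap_apply_of_ne_of_ne (by simp [letter, I]; omega) (by simp [letter, I])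
  have sJ1 : simple J (letter (i + 1) ⟨by omega, hi3.2⟩)
      = letter (i + 1 + 1) ⟨by omega, hj3.2⟩ :=
    Equiv.swap_apply_left _ _
  have sJ2 : simple J (letter (i + 1 + 1) ⟨by omega, hj3.2⟩)
      = letter (i + 1) ⟨by omega, hi3.2⟩ :=
    Equiv.swap_apply_right _ _
  have sJ3 : simple J (letter i ⟨hi3.1, hi3.2.le⟩) = letter i ⟨hi3.1, hi3.2.le⟩ :=
    Equiv.swap_apply_of_ne_of_ne (by simp [letter, J]; omega) (by simp [letter, J])
  apply Finsupp.lhom_ext'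
  intro w
  apply LinearMap.ext_ring
  simp only [LinearMap.comp_apply, Finsupp.lsingle_apply, Module.End.mul_apply]
  have AI : ∀ u : Equiv.Perm (Fin n), Asc I u ↔
      u⁻¹ (letter i ⟨hi3.1, hi3.2.le⟩) < u⁻¹ (letter (i + 1) ⟨by omega, hi3.2⟩) :=
    fun _ => Iff.rfl
  have AJ : ∀ u : Equiv.Perm (Fin n), Asc J u ↔
      u⁻¹ (letter (i + 1) ⟨by omega, hi3.2⟩) < u⁻¹ (letter (i + 1 + 1) ⟨by omega, hj3.2⟩) :=
    fun _ => Iff.rfl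
  have e1 : simple J * (simple I * (simple J * w)) = simple I * (simple J * (simple I * w)) := by
    simp only [← mul_assoc]
    rw [simple_braid I J rfl]
  have hxy : w⁻¹ (letter i ⟨hi3.1, hi3.2.le⟩) ≠ w⁻¹ (letter (i + 1) ⟨by omega, hi3.2⟩) := by
    rw [(w⁻¹).injective.ne_iff]; simp [letter]; omega
  have hyz : w⁻¹ (letter (i + 1) ⟨by omega, hi3.2⟩) ≠
      w⁻¹ (letter (i + 1 + 1) ⟨by omega, hj3.2⟩) := by
    rw [(w⁻¹).injective.ne_iff]; simp [letter]
  have hxz : w⁻¹ (letter i ⟨hi3.1, hi3.2.le⟩) ≠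
      w⁻¹ (letter (i + 1 + 1) ⟨by omega, hj3.2⟩) := by
    rw [(w⁻¹).injective.ne_iff]; simp [letter]
  rcases lt_or_gt_of_ne hxy with h1 | h1 <;> rcases lt_or_gt_of_ne hyz with h2 | h2 <;>
    rcases lt_or_gt_of_ne hxz with h3 | h3 <;>
    first
    | exact absurd (h1.trans h2) (not_lt.2 h3.le)
    | exact absurd (h2.trans h1) (not_lt.2 h3.le)
    | (simp only [leftOp, Finsupp.linearCombination_single, one_smul, map_add, map_smul, AI, AJ,
        mul_inv_rev, simple_inv, Equiv.Perm.mul_apply, sI1, sI2, sI3, sJ1, sJ2, sJ3, h1, h2, h3,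
        not_lt.2 h1.le, not_lt.2 h2.le, not_lt.2 h3.le, if_true, if_false, add_zero,
        simple_mul_cancel, e1, smul_add]
       try abel)

/-- The action of the Hecke algebra on coordinate vectors. -/
noncomputable def leftRep (n : ℕ) :
    HeckeAlgebra n →ₐ[ℤ[X]] Module.End ℤ[X] (Equiv.Perm (Fin n) →₀ ℤ[X]) :=
  RingQuot.liftAlgHom ℤ[X] ⟨FreeAlgebra.lift ℤ[X] leftOp, by
    intro a b hab
    induction hab with
    | comm i j h =>
      simp only [map_mul, FreeAlgebra.lift_ι_apply]
      rcases h with h | h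
      · exact leftOp_comm i j h
      · exact (leftOp_comm j i h).symm
    | braid i j h =>
      simp only [map_mul, FreeAlgebra.lift_ι_apply]
      exact leftOp_braid i j h
    | quad i =>
      simp only [map_mul, map_add, map_one, map_smul, FreeAlgebra.lift_ι_apply]
      exact leftOp_sq i⟩

theorem leftRep_gen {n : ℕ} (i : Idx n) : leftRep n (gen i) = leftOp i := by
  simp [leftRep, gen]

theorem leftRep_T {n : ℕ} (w : Equiv.Perm (Fin n)) :
    leftRep n (T w) (Finsupp.single 1 1) = Finsupp.single w 1 := by
  obtain ⟨l, hl, rfl⟩ := exists_reduced w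
  rw [T_eq _ l hl rfl]
  induction l with
  | nil => simp [wordProd]
  | cons i l ih =>
    obtain ⟨h1, h2⟩ := (isReduced_cons i l).1 hl
    rw [List.map_cons, List.prod_cons, map_mul, Module.End.mul_apply, ih h1, leftRep_gen,
      leftOp_of_asc h2, wordProd_cons]

theorem linearIndependent_T (n : ℕ) :
    LinearIndependent ℤ[X] (T : Equiv.Perm (Fin n) → HeckeAlgebra n) := by
  apply LinearIndependent.of_comp
    ((LinearMap.applyₗ (Finsupp.single (1 : Equiv.Perm (Fin n)) (1 : ℤ[X]))).comp
      (leftRep n).toLinearMap)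
  have : (((LinearMap.applyₗ (Finsupp.single (1 : Equiv.Perm (Fin n)) (1 : ℤ[X]))).comp
      (leftRep n).toLinearMap) ∘ T) = fun w => Finsupp.single w 1 := by
    funext w
    simp [leftRep_T]
  rw [this]
  exact Finsupp.linearIndependent_single_one _ _

theorem span_T (n : ℕ) :
    ⊤ ≤ Submodule.span ℤ[X] (Set.range (T : Equiv.Perm (Fin n) → HeckeAlgebra n)) := by
  set N := Submodule.span ℤ[X] (Set.range (T : Equiv.Perm (Fin n) → HeckeAlgebra n))
  have hT : ∀ w, T w ∈ N := fun w => Submodule.subset_span ⟨w, rfl⟩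
  have hgen : ∀ i, ∀ y ∈ N, gen i * y ∈ N := by
    intro i y hy
    induction hy using Submodule.span_induction with
    | mem x hx =>
      obtain ⟨w, rfl⟩ := hx
      by_cases h : Asc i w
      · rw [gen_mul_T_of_asc h]; exact hT _
      · rw [gen_mul_T_of_not_asc h]; exact N.add_mem (hT _) (N.smul_mem _ (hT _))
    | zero => rw [mul_zero]; exact N.zero_mem
    | add a b _ _ ha hb => rw [mul_add]; exact N.add_mem ha hb
    | smul c a _ ha => rw [mul_smul_comm]; exact N.smul_mem _ ha
  have hall : ∀ (a : FreeAlgebra ℤ[X] (Idx n)), ∀ y ∈ N,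
      RingQuot.mkAlgHom ℤ[X] (HeckeRel n) a * y ∈ N := by
    intro a
    induction a using FreeAlgebra.induction with
    | grade0 r =>
      intro y hy
      rw [AlgHom.commutes, ← Algebra.smul_def]; exact N.smul_mem _ hy
    | grade1 i => exact hgen i
    | mul a b ha hb =>
      intro y hy
      rw [map_mul, mul_assoc]; exact ha _ (hb _ hy)
    | add a b ha hb =>
      intro y hy
      rw [map_add, add_mul]; exact N.add_mem (ha _ hy) (hb _ hy)
  intro x _
  obtain ⟨a, rfl⟩ := RingQuot.mkAlgHom_surjective ℤ[X] (HeckeRel n) x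
  have := hall a (T 1) (hT 1)
  rwa [T_one, mul_one] at this

/-- The `ℤ[ξ]`-basis of the Hecke algebra consisting of the elements `T_w`. -/
noncomputable def basisT (n : ℕ) : Module.Basis (Equiv.Perm (Fin n)) ℤ[X] (HeckeAlgebra n) :=
  Module.Basis.mk (linearIndependent_T n) (span_T n)

theorem basisT_apply {n : ℕ} (w : Equiv.Perm (Fin n)) : basisT n w = T w :=
  Module.Basis.mk_apply _ _ w

/-- The structure constant `f_{xyz}`: the coefficient of `T_z` in `T_x T_y`. -/
noncomputable def structConst {n : ℕ} (x y z : Equiv.Perm (Fin n)) : ℤ[X] :=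
  (basisT n).repr (T x * T y) z

/-- The inclusion of `ℕ[ξ]` in `ℤ[ξ]`. -/
noncomputable def natPoly : ℕ[X] →+* ℤ[X] := Polynomial.mapRingHom (Nat.castRingHom ℤ)

/-! ### The elements `d_m` and the subgroups `P_m` -/

/-- `#(w)`: the least number of occurrences of `s_k` in a reduced word of `w`. -/
noncomputable def hash {n : ℕ} (k : Idx n) (w : Equiv.Perm (Fin n)) : ℕ :=
  sInf {c | ∃ l : List (Idx n), IsReduced l ∧ wordProd l = w ∧ l.count k = c}

/-- The maximal parabolic subgroup `S_{(k, n-k)}`, generated by the `s_i` with `i ≠ k`. -/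
def maxParabolic {n : ℕ} (k : Idx n) : Subgroup (Equiv.Perm (Fin n)) :=
  Subgroup.closure (simple '' {i | i ≠ k})

/-- `d_m = (k  k+m)(k-1  k+m-1) ⋯ (k+1-m  k+1)`, for `0 ≤ m ≤ min k (n-k)`. -/
def dElt {n : ℕ} (k : Idx n) (m : ℕ) (hm : m ≤ min k.1 (n - k.1)) : Equiv.Perm (Fin n) :=
  (List.ofFn fun j : Fin m =>
    Equiv.swap (letter (k.1 - j.1) (by omega) : Fin n) (letter (k.1 + m - j.1) (by omega))).prod

/-- `P_m = S_λ ∩ S_λ^{d_m}` with `λ = (k, n-k)` and `S_λ^d = d⁻¹ S_λ d`. -/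
def P {n : ℕ} (k : Idx n) (m : ℕ) (hm : m ≤ min k.1 (n - k.1)) : Subgroup (Equiv.Perm (Fin n)) :=
  maxParabolic k ⊓ (maxParabolic k).map (MulAut.conj (dElt k m hm)⁻¹).toMonoidHom

end HeckeSym

namespace HeckeSym

variable {n : ℕ}

/-! ### Words and the maximal parabolic subgroup -/

/-! Write `S` for `maxParabolic k` and `d` for `dElt k m hm`. The element `d` is an involution that
interchanges two adjacent intervals of `m` letters, one on each side of the cut at `k`, by
translation. Hence it is increasing on each of the two blocks preserved by `S`, so it has minimal
length in both `S d` and `d S`. Lengths then add: `T w * T d = T (w * d)` and `T d * T w = T (d *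
w)` for `w ∈ S`.

For the bilinear form with orthonormal basis `T w`, left multiplication by `T x` is adjoint to left
multiplication by `T x⁻¹`. For `w ∈ S` the coefficient of `T w` in `T d * T d` is therefore the
pairing of `T d` with `T d * T w = T (d * w)`, which is 1 if `w = 1` and 0 otherwise
(`structConst_dElt`). Every other term lies outside `S`, where each reduced word contains `s_k`
(`one_le_hash`). Positivity holds because multiplying a basis element by a generator produces only
the coefficients 1 and `ξ`.

For the second claim put `v' = d * v * d`, an element of `S` when `v ∈ P_m`. Then `T d * T v = T (d
* v) = T v' * T d`, so the product is `T v' * T d ^ 2`. Left multiplication by `T v'` keeps the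
terms outside `S`, since the complement of `S` is stable under left multiplication by `S`
(`T_mul_mem_natSpan_compl`). -/

theorem wordProd_reverse (l : List (Idx n)) : wordProd l.reverse = (wordProd l)⁻¹ := by
  simp [wordProd, List.prod_inv_reverse, Function.comp_def, simple_inv]

theorem IsReduced.reverse {l : List (Idx n)} (hl : IsReduced l) : IsReduced l.reverse := by
  intro l' h'
  rw [List.length_reverse, ← List.length_reverse (as := l')]
  exact hl _ (by rw [wordProd_reverse, h', wordProd_reverse, inv_inv])

theorem wordProd_append (l l' : List (Idx n)) :
    wordProd (l ++ l') = wordProd l * wordProd l' := by simp [wordProd]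

theorem T_mul_T_of_isReduced_append {l l' : List (Idx n)} (h : IsReduced (l ++ l'))
    (hl : IsReduced l) (hl' : IsReduced l') :
    T (wordProd l) * T (wordProd l') = T (wordProd l * wordProd l') := by
  rw [T_eq _ l hl rfl, T_eq _ l' hl' rfl, T_eq _ _ h (wordProd_append l l'), List.map_append,
    List.prod_append]

/-- Elements of the maximal parabolic subgroup preserve the first block of letters. -/
theorem apply_lt_iff_of_mem_maxParabolic {k : Idx n} {w : Equiv.Perm (Fin n)}
    (hw : w ∈ maxParabolic k) (x : Fin n) : (w x).1 < k.1 ↔ x.1 < k.1 := by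
  induction hw using Subgroup.closure_induction generalizing x with
  | mem u hu =>
    obtain ⟨i, hi, rfl⟩ := hu
    -- Counting from 0, `simple i` exchanges the values `i - 1` and `i`; the threshold `k` separates
    -- them only when `i = k`.
    have hik : i.1 ≠ k.1 := fun e => hi (Subtype.ext e)
    have := i.2
    rw [simple_val]
    split_ifs <;> omega
  | one => rfl
  | mul a b _ _ ha hb => rw [Equiv.Perm.mul_apply, ha, hb]
  | inv a _ ha => rw [← ha, ← Equiv.Perm.mul_apply, mul_inv_cancel, Equiv.Perm.one_apply]

theorem simple_mem_maxParabolic {k i : Idx n} (h : i ≠ k) : simple i ∈ maxParabolic k :=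
  Subgroup.subset_closure ⟨i, h, rfl⟩

theorem wordProd_mem_maxParabolic {k : Idx n} {l : List (Idx n)} (h : k ∉ l) :
    wordProd l ∈ maxParabolic k := by
  refine Subgroup.list_prod_mem _ fun u hu => ?_
  obtain ⟨i, hi, rfl⟩ := List.mem_map.1 hu
  exact simple_mem_maxParabolic fun e => h (e ▸ hi)

/-- The letters `k` and `k + 1` lie in different blocks, both of which `w⁻¹` preserves, so their
order cannot be reversed. -/
theorem asc_of_mem_maxParabolic {k : Idx n} {w : Equiv.Perm (Fin n)}
    (hw : w ∈ maxParabolic k) : Asc k w := by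
  have hk := k.2
  have h1 := apply_lt_iff_of_mem_maxParabolic (inv_mem hw) (letter k.1 ⟨k.2.1, k.2.2.le⟩)
  have h2 := apply_lt_iff_of_mem_maxParabolic (inv_mem hw)
    (letter (k.1 + 1) ⟨by omega, k.2.2⟩)
  simp only [letter] at h1 h2
  rw [Asc, Fin.lt_def]
  simp only [letter]
  omega

/-- Elements of the maximal parabolic subgroup have reduced words avoiding `s_k`. -/
theorem exists_reduced_notMem {k : Idx n} {w : Equiv.Perm (Fin n)} (hw : w ∈ maxParabolic k) :
    ∃ l : List (Idx n), IsReduced l ∧ wordProd l = w ∧ k ∉ l := by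
  -- Induction on the length: a left descent of `w` is never `s_k`, so stripping it off stays in the
  -- subgroup.
  induction hN : (invSet w).card using Nat.strong_induction_on generalizing w with
  | _ N ih =>
  by_cases h1 : w = 1
  · exact ⟨[], fun _ _ => Nat.zero_le _, by simp [wordProd, h1], by simp⟩
  obtain ⟨i, hi⟩ := exists_not_asc h1
  have hik : i ≠ k := by
    rintro rfl
    exact hi (asc_of_mem_maxParabolic hw)
  have hcard := card_invSet_of_not_asc hi
  obtain ⟨l, hl, hlw, hkl⟩ := ih _ (by omega)
    (mul_mem (simple_mem_maxParabolic hik) hw) rfl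
  refine ⟨i :: l, (isReduced_cons i l).2 ⟨hl, ?_⟩, ?_, ?_⟩
  · rw [hlw]; exact (asc_simple_mul i w).2 hi
  · rw [wordProd_cons, hlw, simple_mul_cancel]
  · simp [hkl, hik.symm]

theorem one_le_hash {k : Idx n} {w : Equiv.Perm (Fin n)} (hw : w ∉ maxParabolic k) :
    1 ≤ hash k w := by
  -- The infimum is 0 either because some reduced word avoids `s_k` or by the convention `sInf ∅ =
  -- 0`; both must be excluded.
  rw [Nat.one_le_iff_ne_zero, hash, Ne, Nat.sInf_eq_zero]
  rintro (⟨l, -, hlw, hl⟩ | h)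
  · exact hw (hlw ▸ wordProd_mem_maxParabolic (List.count_eq_zero.1 hl))
  · obtain ⟨l, hl, hlw⟩ := exists_reduced w
    exact Set.eq_empty_iff_forall_notMem.1 h _ ⟨l, hl, hlw, rfl⟩

/-! ### Minimal coset representatives -/

/-- If `d⁻¹` is increasing on both blocks, a reduced word of an element of the parabolic subgroup
followed by a reduced word of `d` is reduced. -/
theorem isReduced_append_of_strictMono {k : Idx n} {l l' : List (Idx n)} (hl : IsReduced l)
    (hkl : k ∉ l) (hl' : IsReduced l')
    (hd : ∀ a b : Fin n, a < b → (a.1 < k.1 ↔ b.1 < k.1) →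
      (wordProd l')⁻¹ a < (wordProd l')⁻¹ b) : IsReduced (l ++ l') := by
  induction l with
  | nil => exact hl'
  | cons i l ih =>
    rw [List.mem_cons, not_or] at hkl
    obtain ⟨h1, h2⟩ := (isReduced_cons i l).1 hl
    refine (isReduced_cons i _).2 ⟨ih h1 hkl.2, ?_⟩
    change Asc i (wordProd (l ++ l'))
    rw [wordProd_append, Asc, mul_inv_rev, Equiv.Perm.mul_apply, Equiv.Perm.mul_apply]
    have hmem := inv_mem (wordProd_mem_maxParabolic hkl.2)
    -- `h2` orders the preimages of `i` and `i + 1` under `wordProd l`. Since `i ≠ k` these lie in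
    -- one block, where `hd` applies.
    refine hd _ _ h2 ?_
    rw [apply_lt_iff_of_mem_maxParabolic hmem, apply_lt_iff_of_mem_maxParabolic hmem]
    have hik : k.1 ≠ i.1 := fun e => hkl.1 (Subtype.ext e)
    have := i.2
    simp only [letter]
    omega

/-- The hypothesis on `d⁻¹` makes `d` the shortest element of its coset `S d`, so the lengths of `w`
and `d` add. -/
theorem T_mul_T_of_mem_maxParabolic {k : Idx n} {w d : Equiv.Perm (Fin n)}
    (hw : w ∈ maxParabolic k)
    (hd : ∀ a b : Fin n, a < b → (a.1 < k.1 ↔ b.1 < k.1) → d⁻¹ a < d⁻¹ b) :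
    T w * T d = T (w * d) := by
  obtain ⟨l, hl, rfl, hkl⟩ := exists_reduced_notMem hw
  obtain ⟨l', hl', rfl⟩ := exists_reduced d
  exact T_mul_T_of_isReduced_append (isReduced_append_of_strictMono hl hkl hl' hd) hl hl'

theorem T_mul_T_of_mem_maxParabolic_right {k : Idx n} {w d : Equiv.Perm (Fin n)}
    (hw : w ∈ maxParabolic k)
    (hd : ∀ a b : Fin n, a < b → (a.1 < k.1 ↔ b.1 < k.1) → d a < d b) :
    T d * T w = T (d * w) := by
  obtain ⟨l, hl, rfl, hkl⟩ := exists_reduced_notMem hw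
  obtain ⟨l', hl', rfl⟩ := exists_reduced d
  -- Reversing words passes to inverses and interchanges the two sides.
  have h := (isReduced_append_of_strictMono hl.reverse (by simpa using hkl) hl'.reverse
    (by simpa only [wordProd_reverse, inv_inv] using hd)).reverse
  rw [List.reverse_append, List.reverse_reverse, List.reverse_reverse] at h
  exact T_mul_T_of_isReduced_append h hl' hl

/-! ### The elements `d_m` -/

theorem swap_val_cases (a b x : Fin n) :
    (x.1 = a.1 ∧ (Equiv.swap a b x).1 = b.1) ∨ (x.1 = b.1 ∧ (Equiv.swap a b x).1 = a.1) ∨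
      (x.1 ≠ a.1 ∧ x.1 ≠ b.1 ∧ (Equiv.swap a b x).1 = x.1) := by
  rw [Equiv.swap_apply_def]
  split_ifs with h1 h2
  · exact Or.inl ⟨congrArg _ h1, rfl⟩
  · exact Or.inr (Or.inl ⟨congrArg _ h2, rfl⟩)
  · exact Or.inr (Or.inr ⟨Fin.val_ne_of_ne h1, Fin.val_ne_of_ne h2, rfl⟩)

/-- Only the first `r` of the `m` transpositions are multiplied, with the shift `m` kept fixed, so
that induction on `r` is possible. Counting from 0, they exchange `[k - r, k)` and `[k + m - r, k +
m)`, which are disjoint since `r ≤ m`. -/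
theorem prod_ofFn_swap_val (k : Idx n) (m : ℕ) (hm : m ≤ min k.1 (n - k.1)) (r : ℕ)
    (hr : r ≤ m) (x : Fin n) :
    ((List.ofFn fun j : Fin r =>
      Equiv.swap (letter (k.1 - j.1) (by omega) : Fin n)
        (letter (k.1 + m - j.1) (by omega))).prod x).1 =
      if k.1 ≤ x.1 + r ∧ x.1 < k.1 then x.1 + m
      else if k.1 + m ≤ x.1 + r ∧ x.1 < k.1 + m then x.1 - m else x.1 := by
  induction r generalizing x with
  | zero =>
    simp only [List.ofFn_zero, List.prod_nil, Equiv.Perm.one_apply]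
    split_ifs <;> omega
  | succ r ih =>
    have hk := k.2
    rw [List.ofFn_succ', List.concat_eq_append, List.prod_append, List.prod_singleton,
      Equiv.Perm.mul_apply]
    simp only [Fin.val_castSucc, Fin.val_last]
    rw [ih (by omega)]
    have hy := swap_val_cases (letter (k.1 - r) (by omega) : Fin n)
      (letter (k.1 + m - r) (by omega)) x
    generalize Equiv.swap _ _ x = y at hy ⊢
    simp only [letter] at hy
    clear ih
    rcases hy with hy | hy | hy <;> split_ifs <;> omega

theorem dElt_val (k : Idx n) (m : ℕ) (hm : m ≤ min k.1 (n - k.1)) (x : Fin n) :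
    (dElt k m hm x).1 =
      if k.1 ≤ x.1 + m ∧ x.1 < k.1 then x.1 + m
      else if k.1 ≤ x.1 ∧ x.1 < k.1 + m then x.1 - m else x.1 := by
  rw [dElt, prod_ofFn_swap_val k m hm m le_rfl]
  simp only [Nat.add_le_add_iff_right]

theorem dElt_mul_self (k : Idx n) (m : ℕ) (hm : m ≤ min k.1 (n - k.1)) :
    dElt k m hm * dElt k m hm = 1 := by
  ext x
  rw [Equiv.Perm.mul_apply, dElt_val, dElt_val, Equiv.Perm.one_apply]
  split_ifs <;> omega

theorem dElt_inv (k : Idx n) (m : ℕ) (hm : m ≤ min k.1 (n - k.1)) :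
    (dElt k m hm)⁻¹ = dElt k m hm :=
  inv_eq_of_mul_eq_one_right (dElt_mul_self k m hm)

/-- In the first block only the final `m` letters move, all up by `m`; in the second only the
initial `m`, all down by `m`. As `d_m` is its own inverse, this serves products on both sides. -/
theorem dElt_lt_dElt (k : Idx n) (m : ℕ) (hm : m ≤ min k.1 (n - k.1)) (a b : Fin n)
    (hab : a < b) (h : a.1 < k.1 ↔ b.1 < k.1) : dElt k m hm a < dElt k m hm b := by
  rw [Fin.lt_def] at hab ⊢
  rw [dElt_val, dElt_val]
  split_ifs <;> omega

/-! ### The symmetric form with orthonormal basis `T_w` -/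

theorem toDual_T (x y : Equiv.Perm (Fin n)) :
    (basisT n).toDual (T x) (T y) = if x = y then 1 else 0 := by
  rw [← basisT_apply, ← basisT_apply, Module.Basis.toDual_apply]

/-- The matrix of left multiplication by `gen i` in the basis `T w` is symmetric: its entries 1 join
`x` and `simple i * x` in both directions, and the entries `ξ` are diagonal. -/
theorem toDual_gen_mul (i : Idx n) (a b : HeckeAlgebra n) :
    (basisT n).toDual (gen i * a) b = (basisT n).toDual a (gen i * b) := by
  have key : (basisT n).toDual ∘ₗ LinearMap.mulLeft ℤ[X] (gen i) =
      (basisT n).toDual.compl₂ (LinearMap.mulLeft ℤ[X] (gen i)) := by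
    refine (basisT n).ext fun x => (basisT n).ext fun y => ?_
    simp only [LinearMap.comp_apply, LinearMap.compl₂_apply, LinearMap.mulLeft_apply,
      basisT_apply]
    have e : simple i * x = y ↔ x = simple i * y :=
      ⟨fun h => by rw [← h, simple_mul_cancel], fun h => by rw [h, simple_mul_cancel]⟩
    by_cases hx : Asc i x <;> by_cases hy : Asc i y
    · simp only [gen_mul_T_of_asc hx, gen_mul_T_of_asc hy, toDual_T, e]
    · have hne : x ≠ y := fun h => hy (h ▸ hx)
      simp [gen_mul_T_of_asc hx, gen_mul_T_of_not_asc hy, toDual_T, e, hne]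
    · have hne : x ≠ y := fun h => hx (h ▸ hy)
      simp [gen_mul_T_of_not_asc hx, gen_mul_T_of_asc hy, toDual_T, e, hne]
    · simp [gen_mul_T_of_not_asc hx, gen_mul_T_of_not_asc hy, toDual_T, e]
  exact LinearMap.congr_fun₂ key a b

theorem toDual_prod_gen_mul (l : List (Idx n)) (a b : HeckeAlgebra n) :
    (basisT n).toDual ((l.map gen).prod * a) b =
      (basisT n).toDual a ((l.reverse.map gen).prod * b) := by
  induction l generalizing b with
  | nil => simp
  | cons i l ih =>
    rw [List.map_cons, List.prod_cons, mul_assoc, toDual_gen_mul, ih, List.reverse_cons,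
      List.map_append, List.prod_append]
    simp [mul_assoc]

/-- Left multiplication by `T_x` is adjoint to left multiplication by `T_{x⁻¹}`. -/
theorem toDual_T_mul (x : Equiv.Perm (Fin n)) (a b : HeckeAlgebra n) :
    (basisT n).toDual (T x * a) b = (basisT n).toDual a (T x⁻¹ * b) := by
  obtain ⟨l, hl, rfl⟩ := exists_reduced x
  rw [T_eq _ l hl rfl, toDual_prod_gen_mul, T_eq _ _ hl.reverse (wordProd_reverse l)]

/-- Adjointness trades a coefficient of `T x * T y` for one of `T x⁻¹ * T z`, a product that may be
known exactly. -/
theorem structConst_eq_toDual (x y z : Equiv.Perm (Fin n)) :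
    structConst x y z = (basisT n).toDual (T y) (T x⁻¹ * T z) := by
  rw [← toDual_T_mul, ← basisT_apply z, Module.Basis.toDual_apply_left, structConst]

/-! ### Combinations with coefficients in `ℕ[ξ]` -/

/-- The combinations of the `T_w`, `w ∈ A`, with coefficients in `ℕ[ξ]`. -/
def natSpan (A : Set (Equiv.Perm (Fin n))) : Set (HeckeAlgebra n) :=
  {a | ∃ g : Equiv.Perm (Fin n) → ℕ[X], a = ∑ w, natPoly (g w) • T w ∧ ∀ w, g w ≠ 0 → w ∈ A}

theorem zero_mem_natSpan (A : Set (Equiv.Perm (Fin n))) : 0 ∈ natSpan A :=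
  ⟨0, by simp, by simp⟩

theorem add_mem_natSpan {A : Set (Equiv.Perm (Fin n))} {a b : HeckeAlgebra n}
    (ha : a ∈ natSpan A) (hb : b ∈ natSpan A) : a + b ∈ natSpan A := by
  obtain ⟨g, rfl, hg⟩ := ha
  obtain ⟨h, rfl, hh⟩ := hb
  refine ⟨g + h, by simp [add_smul, Finset.sum_add_distrib], fun w hw => ?_⟩
  by_contra hA
  exact hw (by rw [Pi.add_apply, not_imp_comm.1 (hg w) hA, not_imp_comm.1 (hh w) hA, add_zero])

theorem smul_mem_natSpan {A : Set (Equiv.Perm (Fin n))} {a : HeckeAlgebra n} (c : ℕ[X])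
    (ha : a ∈ natSpan A) : natPoly c • a ∈ natSpan A := by
  obtain ⟨g, rfl, hg⟩ := ha
  exact ⟨fun w => c * g w, by simp [Finset.smul_sum, mul_smul],
    fun w hw => hg w (right_ne_zero_of_mul hw)⟩

theorem T_mem_natSpan {A : Set (Equiv.Perm (Fin n))} {w : Equiv.Perm (Fin n)} (hw : w ∈ A) :
    T w ∈ natSpan A := by
  refine ⟨Pi.single w 1, ?_, fun u hu => ?_⟩
  · rw [Finset.sum_eq_single w] <;> simp +contextual
  · by_cases h : u = w
    · exact h ▸ hw
    · exact absurd (Pi.single_eq_of_ne h 1) hu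

theorem sum_mem_natSpan {A : Set (Equiv.Perm (Fin n))} {ι : Type*} (s : Finset ι)
    (a : ι → HeckeAlgebra n) (h : ∀ j ∈ s, a j ∈ natSpan A) : ∑ j ∈ s, a j ∈ natSpan A :=
  Finset.sum_induction a (· ∈ natSpan A) (fun _ _ => add_mem_natSpan) (zero_mem_natSpan A) h

/-- The product of `gen i` and `T w` involves only `T (simple i * w)` and `T w`, with coefficients 1
and 0 or `ξ`. -/
theorem gen_mul_mem_natSpan {A : Set (Equiv.Perm (Fin n))} {i : Idx n}
    (hA : ∀ w ∈ A, simple i * w ∈ A) {a : HeckeAlgebra n} (ha : a ∈ natSpan A) :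
    gen i * a ∈ natSpan A := by
  obtain ⟨g, rfl, hg⟩ := ha
  rw [Finset.mul_sum]
  refine sum_mem_natSpan _ _ fun w _ => ?_
  rw [mul_smul_comm]
  by_cases h0 : g w = 0
  · rw [h0, map_zero, zero_smul]; exact zero_mem_natSpan A
  refine smul_mem_natSpan _ ?_
  have hw := hg w h0
  by_cases h : Asc i w
  · rw [gen_mul_T_of_asc h]
    exact T_mem_natSpan (hA w hw)
  · rw [gen_mul_T_of_not_asc h, show (X : ℤ[X]) = natPoly X by simp [natPoly]]
    exact add_mem_natSpan (T_mem_natSpan (hA w hw)) (smul_mem_natSpan _ (T_mem_natSpan hw))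

theorem prod_gen_mul_mem_natSpan {A : Set (Equiv.Perm (Fin n))} (l : List (Idx n))
    (hA : ∀ i ∈ l, ∀ w ∈ A, simple i * w ∈ A) {a : HeckeAlgebra n} (ha : a ∈ natSpan A) :
    (l.map gen).prod * a ∈ natSpan A := by
  induction l with
  | nil => simpa using ha
  | cons i l ih =>
    rw [List.map_cons, List.prod_cons, mul_assoc]
    exact gen_mul_mem_natSpan (hA i (by simp)) (ih fun j hj => hA j (by simp [hj]))

theorem T_mul_T_mem_natSpan (x y : Equiv.Perm (Fin n)) : T x * T y ∈ natSpan Set.univ := by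
  obtain ⟨l, hl, rfl⟩ := exists_reduced x
  rw [T_eq _ l hl rfl]
  exact prod_gen_mul_mem_natSpan l (fun _ _ _ _ => Set.mem_univ _)
    (T_mem_natSpan (Set.mem_univ y))

/-- A reduced word of `v` avoiding `s_k` multiplies by generators in the subgroup only, and these
preserve the complement of the subgroup. -/
theorem T_mul_mem_natSpan_compl {k : Idx n} {v : Equiv.Perm (Fin n)} (hv : v ∈ maxParabolic k)
    {a : HeckeAlgebra n} (ha : a ∈ natSpan (maxParabolic k : Set (Equiv.Perm (Fin n)))ᶜ) :
    T v * a ∈ natSpan (maxParabolic k : Set (Equiv.Perm (Fin n)))ᶜ := by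
  obtain ⟨l, hl, rfl, hkl⟩ := exists_reduced_notMem hv
  rw [T_eq _ l hl rfl]
  refine prod_gen_mul_mem_natSpan (A := (maxParabolic k : Set (Equiv.Perm (Fin n)))ᶜ) l
    (fun i hi w hw h => hw <| (Subgroup.mul_mem_cancel_left _
    (simple_mem_maxParabolic fun (e : i = k) => hkl (e ▸ hi))).1 h) ha

/-! ### Coordinates and positivity of the structure constants -/

theorem repr_sum_smul_T (c : Equiv.Perm (Fin n) → ℤ[X]) (w : Equiv.Perm (Fin n)) :
    (basisT n).repr (∑ u, c u • T u) w = c w := by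
  simp only [← basisT_apply]
  rw [(basisT n).repr_sum_self]

/-- The structure constants lie in `ℕ[ξ]`. -/
theorem exists_natPoly_eq_structConst (x y : Equiv.Perm (Fin n)) :
    ∃ g : Equiv.Perm (Fin n) → ℕ[X], ∀ w, natPoly (g w) = structConst x y w := by
  obtain ⟨g, hg, -⟩ := T_mul_T_mem_natSpan x y
  exact ⟨g, fun w => by rw [structConst, hg, repr_sum_smul_T]⟩

theorem T_mul_T_eq_sum (x y : Equiv.Perm (Fin n)) :
    T x * T y = ∑ w, structConst x y w • T w := by
  simpa only [basisT_apply, structConst] using ((basisT n).sum_repr (T x * T y)).symm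

/-! ### The square of `T_{d_m}` -/

/-- The key computation: since `d_m` is an involution, the coefficient is the pairing of `T d_m`
with `T d_m * T w`. Lengths add, so the latter is the single basis element `T (d_m * w)`, equal to
`T d_m` only for `w = 1`. -/
theorem structConst_dElt (k : Idx n) (m : ℕ) (hm : m ≤ min k.1 (n - k.1))
    {w : Equiv.Perm (Fin n)} (hw : w ∈ maxParabolic k) :
    structConst (dElt k m hm) (dElt k m hm) w = if w = 1 then 1 else 0 := by
  rw [structConst_eq_toDual, dElt_inv, T_mul_T_of_mem_maxParabolic_right hw
    (dElt_lt_dElt k m hm), toDual_T]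
  simp only [left_eq_mul]

theorem natPoly_injective : Function.Injective natPoly :=
  Polynomial.map_injective _ Nat.cast_injective

theorem exists_T_dElt_sq (k : Idx n) (m : ℕ) (hm : m ≤ min k.1 (n - k.1)) :
    ∃ f : Equiv.Perm (Fin n) → ℕ[X],
      (∀ w, w ≠ 1 → natPoly (f w) = structConst (dElt k m hm) (dElt k m hm) w) ∧
      T (dElt k m hm) ^ 2 = T 1 + ∑ w, natPoly (f w) • T w ∧
      ∀ w, f w ≠ 0 → w ∉ maxParabolic k := by
  obtain ⟨g, hg⟩ := exists_natPoly_eq_structConst (dElt k m hm) (dElt k m hm)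
  -- The coefficient of `T 1` equals 1 and is split off as the separate term, so `f 1` is set to 0.
  refine ⟨Function.update g 1 0, fun w hw => by rw [Function.update_of_ne hw, hg], ?_, ?_⟩
  · rw [sq, T_mul_T_eq_sum, ← Finset.add_sum_erase _ _ (Finset.mem_univ 1),
      ← Finset.add_sum_erase _ (fun w => natPoly (Function.update g 1 0 w) • T w)
        (Finset.mem_univ 1), structConst_dElt k m hm (one_mem _)]
    simp only [if_true, one_smul, Function.update_self, map_zero, zero_smul, zero_add]
    congr 1
    refine Finset.sum_congr rfl fun w hw => ?_
    rw [Function.update_of_ne (Finset.ne_of_mem_erase hw), hg]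
  · intro w hf hw
    have h1 : w ≠ 1 := by
      rintro rfl
      exact hf (Function.update_self _ _ _)
    rw [Function.update_of_ne h1] at hf
    refine hf (natPoly_injective ?_)
    rw [hg, structConst_dElt k m hm hw, if_neg h1, map_zero]

/-! ### Conjugation by `d_m` -/

theorem T_dElt_mul_T_mul_T_dElt (k : Idx n) (m : ℕ) (hm : m ≤ min k.1 (n - k.1))
    {v : Equiv.Perm (Fin n)} (hv : v ∈ maxParabolic k)
    (hdv : dElt k m hm * v * dElt k m hm ∈ maxParabolic k) :
    T (dElt k m hm) * T v * T (dElt k m hm) =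
      T (dElt k m hm * v * dElt k m hm) * T (dElt k m hm) ^ 2 := by
  -- Both `T d * T v` and `T (d * v * d) * T d` equal `T (d * v)`, by additivity of lengths and `d *
  -- d = 1`.
  rw [sq, ← mul_assoc, T_mul_T_of_mem_maxParabolic hdv
    (by rw [dElt_inv]; exact dElt_lt_dElt k m hm),
    T_mul_T_of_mem_maxParabolic_right hv (dElt_lt_dElt k m hm), mul_assoc _ _ (dElt k m hm),
    dElt_mul_self, mul_one]

theorem conj_dElt_mem_maxParabolic {k : Idx n} {m : ℕ} {hm : m ≤ min k.1 (n - k.1)}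
    {v : Equiv.Perm (Fin n)} (hv : v ∈ P k m hm) :
    dElt k m hm * v * dElt k m hm ∈ maxParabolic k := by
  obtain ⟨u, hu, rfl⟩ := Subgroup.mem_map.1 hv.2
  have e : dElt k m hm * (MulAut.conj (dElt k m hm)⁻¹).toMonoidHom u * dElt k m hm = u := by
    change dElt k m hm * ((dElt k m hm)⁻¹ * u * (dElt k m hm)⁻¹⁻¹) * dElt k m hm = u
    rw [inv_inv, mul_assoc, mul_assoc, mul_assoc, dElt_mul_self, mul_one, mul_inv_cancel_left]
  rwa [e]

end HeckeSym

theorem mainTheorem8 (n : ℕ) (k : HeckeSym.Idx n) (m : ℕ) (hm : m ≤ min k.1 (n - k.1)) :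
    (∃ f : Equiv.Perm (Fin n) → Polynomial ℕ,
      (∀ w, w ≠ 1 → HeckeSym.natPoly (f w) =
        HeckeSym.structConst (HeckeSym.dElt k m hm) (HeckeSym.dElt k m hm) w) ∧
      (HeckeSym.T (HeckeSym.dElt k m hm)) ^ 2 =
        HeckeSym.T 1 + ∑ w, HeckeSym.natPoly (f w) • HeckeSym.T w ∧
      ∀ w, f w ≠ 0 → 1 ≤ HeckeSym.hash k w) ∧
    ∀ v ∈ HeckeSym.P k m hm, ∃ g : Equiv.Perm (Fin n) → Polynomial ℕ,
      HeckeSym.T (HeckeSym.dElt k m hm) * HeckeSym.T v * HeckeSym.T (HeckeSym.dElt k m hm) =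
        HeckeSym.T (HeckeSym.dElt k m hm * v * HeckeSym.dElt k m hm) +
          ∑ w, HeckeSym.natPoly (g w) • HeckeSym.T w ∧
      ∀ w, g w ≠ 0 → 1 ≤ HeckeSym.hash k w := by
  obtain ⟨f, hf1, hf2, hf3⟩ := HeckeSym.exists_T_dElt_sq k m hm
  refine ⟨⟨f, hf1, hf2, fun w hw => HeckeSym.one_le_hash (hf3 w hw)⟩, fun v hv => ?_⟩
  have hdv := HeckeSym.conj_dElt_mem_maxParabolic hv
  -- The remainder in the second claim is `T (d * v * d)` times the remainder in the square of `T
  -- d`.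
  obtain ⟨g, hg1, hg2⟩ := HeckeSym.T_mul_mem_natSpan_compl hdv ⟨f, rfl, hf3⟩
  refine ⟨g, ?_, fun w hw => HeckeSym.one_le_hash (hg2 w hw)⟩
  rw [HeckeSym.T_dElt_mul_T_mul_T_dElt k m hm hv.1 hdv, hf2, mul_add, HeckeSym.T_one, mul_one,
    hg1]
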